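/- Let $(\mathfrak X,+,\mathcal A)$ be a measurable Abelian group (subtraction is measurable from $\mathcal A\otimes\mathcal A$ to $\mathcal A$). For finite signed measures on it, let products and powers be taken with respect to convolution, empty products and zeroth powers being the Dirac measure $\delta_0$, and let $\|V\|=|V|(\mathfrak X)$ be the total variation norm. For $n\in\mathbb N=\{1,2,\dots\}$, probability distributions $F_1,\dots,F_n$ on $\mathfrak X$, and $G=\overline F=\frac1n\sum_{j=1}^nF_j$, put $M_{j,k}=(F_j-G)G^{\lfloor (n-k)/k\rfloor}$ for $j,k\in\{1,\dots,n\}$, $\nu_{k,2}=\sum_{j=1}^n\|M_{j,k}\|^2$, $\widetilde\nu_k=\|\sum_{j=1}^nM_{j,k}\|$, $c_1=\sup_{x>0}\frac{\ln(2-(1-x)e^x)}{x^2}$ and $$\eta_\ell=\max_{k\in\{\ell+1,\dots,n\}}\frac1k\Big(\frac{\widetilde\nu_k^2}{4c_1}+\nu_{k,2}\Big)\qquad(0\le\ell\le n),$$ where the maximum over the empty set is $0$. Put $V_k=\sum_{J\subseteq\{1,\dots,n\},\,|J|=k}\prod_{j\in J}(F_j-G)$ and $W_1=V_0G^n+V_1G^{n-1}$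 (which equals $\overline F^n$). Let $\widetilde u_1$ be the smallest constant $c\in(0,\infty)$ such that $\|\prod_{j=1}^nF_j-W_1\|\le c\,\eta_1$ for all measurable Abelian groups, all $n\in\mathbb N$ and all probability distributions $F_1,\dots,F_n$, with $G=\overline F$. Let $n,d\in\mathbb N$, let $H_0,\dots,H_d$ be probability distributions on $\mathfrak X$, and let $F_j=\sum_{r=0}^dp_{j,r}H_r$ for $j=1,\dots,n$, where $p_{j,r}\in[0,1]$, $\sum_{r=0}^dp_{j,r}=1$ and $\overline p_r=\frac1n\sum_{j=1}^np_{j,r}>0$ for all $r\in\{0,\dots,d\}$. Let $G=\overline F$ $\big(=\sum_{r=0}^d\overline p_rH_r\big)$. Then, for every $\ell\in\{1,\dots,n\}$, $$\eta_\ell\le\sum_{j=1}^n\min\Big\{2\sum_{r=0}^d\frac{(\overline p_r-p_{j,r})^2}{n\overline p_r},\ \frac1{\ell+1}\Big(\sum_{r=0}^d|\overline p_r-p_{j,r}|\Big)^2\Big\}.$$ Moreover $$\Big\|\prod_{j=1}^nF_j-\overline F^n\Big\|\le2\widetilde u_1\sum_{r=1}^d\sum_{j=1}^n\frac{(\overline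 p_r-p_{j,r})^2}{n\overline p_r\overline p_0},\qquad 2\widetilde u_1\le21.88,$$ and consequently $$\Big\|\prod_{j=1}^nF_j-\overline F^n\Big\|\le21.88\sum_{r=1}^d\sum_{j=1}^n\frac{(\overline p_r-p_{j,r})^2}{n\overline p_r\overline p_0}.$$ -/

import Mathlib

open MeasureTheory

universe u

noncomputable section

namespace SignedConv

variable {X : Type u} [MeasurableSpace X]

/-- The total variation norm `|V|(X)` of a finite signed measure. -/
def tvNorm (V : SignedMeasure X) : ℝ := V.totalVariation.real Set.univ

/-- A probability distribution, seen as a finite signed measure. -/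
def ofProb (P : ProbabilityMeasure X) : SignedMeasure X := (P : Measure X).toSignedMeasure

/-- The arithmetic mean `n⁻¹ (F₁ + ⋯ + Fₙ)`. -/
def average {n : ℕ} (F : Fin n → SignedMeasure X) : SignedMeasure X := (n : ℝ)⁻¹ • ∑ j, F j

/-- The product of two signed measures exists, so that it is not a junk value. -/
theorem hasProd_signed {Y : Type*} [MeasurableSpace Y]
    (V : SignedMeasure X) (W : SignedMeasure Y) :
    VectorMeasure.HasProd V W (ContinuousLinearMap.mul ℝ ℝ) := by
  have : IsFiniteMeasure (VectorMeasure.variation V) := by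
    rw [← SignedMeasure.totalVariation_eq_variation]; infer_instance
  infer_instance

section Group

variable [AddCommGroup X]

/-- The convolution of two finite signed measures: the image under addition of their product
measure, which gives mass `V A * W B` to a measurable rectangle `A × B`. -/
def conv (V W : SignedMeasure X) : SignedMeasure X :=
  (VectorMeasure.prod V W (ContinuousLinearMap.mul ℝ ℝ)).map fun x : X × X => x.1 + x.2

/-- The unity of the convolution algebra: the Dirac measure at `0`. -/
def unit : SignedMeasure X := (Measure.dirac (0 : X)).toSignedMeasure

/-- Convolution powers, with `V ^ 0` the Dirac measure at `0`. -/
def convPow (V : SignedMeasure X) : ℕ → SignedMeasure X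
  | 0 => unit
  | m + 1 => conv (convPow V m) V

/-- The convolution product of the `L j`, `j ∈ J`, with the empty product equal to the Dirac
measure at `0`. (Convolution is commutative; the factors are taken in increasing order.) -/
def convProd {n : ℕ} (L : Fin n → SignedMeasure X) (J : Finset (Fin n)) : SignedMeasure X :=
  ((J.sort (· ≤ ·)).map L).foldr conv unit

/-- In a measurable Abelian group (subtraction is jointly measurable), addition is jointly
measurable, so that the push-forward in `conv` is not a junk value. -/
theorem measurable_add_of_sub [MeasurableSub₂ X] :
    Measurable fun x : X × X => x.1 + x.2 := by
  have h : Measurable fun x : X × X => x.1 - ((0 : X) - x.2) :=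
    measurable_fst.sub (measurable_const.sub measurable_snd)
  simpa using h

/-- Convolution of signed measures extends Mathlib's convolution of measures. -/
theorem conv_toSignedMeasure [MeasurableSub₂ X] (μ ν : Measure X) [IsFiniteMeasure μ]
    [IsFiniteMeasure ν] [IsFiniteMeasure (μ.conv ν)] :
    conv μ.toSignedMeasure ν.toSignedMeasure = (μ.conv ν).toSignedMeasure := by
  have h : VectorMeasure.prod μ.toSignedMeasure ν.toSignedMeasure (ContinuousLinearMap.mul ℝ ℝ)
      = (μ.prod ν).toSignedMeasure := by
    apply VectorMeasure.prod_eq_of_forall_apply_prod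
    intro s t hs ht
    simp [hs, ht, hs.prod ht]
  ext s hs
  have hm : Measurable fun x : X × X => x.1 + x.2 := measurable_add_of_sub
  rw [conv, h, VectorMeasure.map_apply _ hm hs,
    Measure.toSignedMeasure_apply_measurable (hm hs), Measure.toSignedMeasure_apply_measurable hs,
    measureReal_def, measureReal_def, Measure.conv, Measure.map_apply hm hs]

/-- `V_k`: the sum over all `J ⊆ {1, …, n}` with `k` elements of `∏_{j ∈ J} (F_j - G)`. -/
def V {n : ℕ} (F : Fin n → SignedMeasure X) (G : SignedMeasure X) (k : ℕ) : SignedMeasure X :=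
  ∑ J ∈ (Finset.univ : Finset (Fin n)).powersetCard k, convProd (fun j => F j - G) J

/-- `W_ℓ = ∑_{k=0}^ℓ V_k G^{n-k}`, for `ℓ ≤ n`. -/
def W {n : ℕ} (F : Fin n → SignedMeasure X) (G : SignedMeasure X) (l : ℕ) : SignedMeasure X :=
  ∑ k ∈ Finset.range (l + 1), conv (V F G k) (convPow G (n - k))

/-- `M_{j,k} = (F_j - G) G^{⌊(n-k)/k⌋}`, for `1 ≤ k ≤ n`. -/
def M {n : ℕ} (F : Fin n → SignedMeasure X) (G : SignedMeasure X) (j : Fin n) (k : ℕ) :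
    SignedMeasure X :=
  conv (F j - G) (convPow G ((n - k) / k))

/-- `ν_{k,m} = ∑_j ‖M_{j,k}‖^m`. -/
def nu {n : ℕ} (F : Fin n → SignedMeasure X) (G : SignedMeasure X) (k m : ℕ) : ℝ :=
  ∑ j, tvNorm (M F G j k) ^ m

/-- `ν̃_k = ‖∑_j M_{j,k}‖`. -/
def nuTilde {n : ℕ} (F : Fin n → SignedMeasure X) (G : SignedMeasure X) (k : ℕ) : ℝ :=
  tvNorm (∑ j, M F G j k)

/-- `c₁ = sup_{x > 0} ln(2 - (1 - x) eˣ) / x²` (about `0.694`). -/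
def c1 : ℝ :=
  sSup ((fun x : ℝ => Real.log (2 - (1 - x) * Real.exp x) / x ^ 2) '' Set.Ioi 0)

/-- `η_{ℓ,α}`: the maximum over `k ∈ {ℓ+1, …, n}` of `k^{-(1+α)} (ν̃_k² / (4 c₁) + ν_{k,2})`,
where the maximum over the empty set (the case `ℓ = n`) is `0`. -/
def etaAlpha {n : ℕ} (F : Fin n → SignedMeasure X) (G : SignedMeasure X) (l : ℕ) (α : ℝ) : ℝ :=
  sSup ((fun k : ℕ =>
    1 / (k : ℝ) ^ (1 + α) * (nuTilde F G k ^ 2 / (4 * c1) + nu F G k 2)) '' Set.Ioc l n)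

/-- `η_ℓ = η_{ℓ,0}`. -/
def eta {n : ℕ} (F : Fin n → SignedMeasure X) (G : SignedMeasure X) (l : ℕ) : ℝ :=
  etaAlpha F G l 0

end Group

/-- `ũ_ℓ`: the smallest constant `c ∈ (0, ∞)` such that
`‖∏_j F_j - W_ℓ‖ ≤ c η₁^{(ℓ+1)/2}` whenever `G` is the mean of the `F_j`, for all probability
distributions `F₁, …, Fₙ` on a measurable Abelian group and all `n ≥ max(ℓ, 1)`. -/
def uTilde (l : ℕ) : ℝ :=
  sInf {c : ℝ | 0 < c ∧
    ∀ (Y : Type u) [AddCommGroup Y] [MeasurableSpace Y] [MeasurableSub₂ Y]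
      (n : ℕ) (P : Fin n → ProbabilityMeasure Y), 1 ≤ n → l ≤ n →
      tvNorm (convProd (fun j => ofProb (P j)) Finset.univ
          - W (fun j => ofProb (P j)) (average fun j => ofProb (P j)) l)
        ≤ c * eta (fun j => ofProb (P j)) (average fun j => ofProb (P j)) 1
            ^ (((l : ℝ) + 1) / 2)}

end SignedConv

end

/-! Under convolution the finite signed measures form a commutative real algebra with
submultiplicative norm `tvNorm`; the core estimates use only such a seminorm. Since G is the mean, ∑
(F_j - G) = 0. Hence ν̃_k = 0, and in the expansion ∏ F_j = ∑_k V_k G^(n-k) the term k = 1 vanishes.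
For k ≥ 2, distributing G^(n-k) over the k factors turns V_k G^(n-k) into the k-th elementary
symmetric function of the M_{j,k}, up to a factor of norm at most 1.

The M_{j,k} also sum to 0, so ∏ (1 + M_j z) = ∏ (1 + M_j z) exp(-M_j z). Each factor on the right
has no linear term, and its coefficients are majorised by those of an explicit real series in ‖M_j‖
(`esymm_le_coeff`). If ∑_j ‖M_{j,k}‖² ≤ k h for all k ≥ 2 and h ≤ 2/10.94, the resulting bounds sum
to at most 10.94 h; for larger h the trivial bound 2 suffices (`prod_sub_pow_le`). Letting h
decrease to η_1 gives ũ_1 ≤ 10.94.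

For mixtures, η_ℓ is bounded by a smoothing inequality (`sq_sum_smul_mul_pow_le`): multiplying a
centred combination by G^m reduces the bound on its squared norm by the factor 1/(m+1), as the
variance of an average of m+1 independent variables. The index 0 is then eliminated by
Cauchy–Schwarz (`sum_sq_div_le`). -/

namespace SignedConv

variable {X : Type u} [MeasurableSpace X]

/-! ### Total variation and the convolution algebra. -/

instance isFiniteMeasure_variation (V : SignedMeasure X) :
    IsFiniteMeasure (VectorMeasure.variation V) := by
  rw [← SignedMeasure.totalVariation_eq_variation]; infer_instance

theorem tvNorm_eq_variation (V : SignedMeasure X) :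
    tvNorm V = (VectorMeasure.variation V).real Set.univ := by
  rw [tvNorm, SignedMeasure.totalVariation_eq_variation]

theorem tvNorm_nonneg (V : SignedMeasure X) : 0 ≤ tvNorm V := measureReal_nonneg

theorem tvNorm_zero : tvNorm (0 : SignedMeasure X) = 0 := by
  simp [tvNorm_eq_variation]

theorem tvNorm_add_le (V W : SignedMeasure X) : tvNorm (V + W) ≤ tvNorm V + tvNorm W := by
  simp only [tvNorm_eq_variation]
  rw [← measureReal_add_apply]
  exact ENNReal.toReal_mono (measure_ne_top _ _) (VectorMeasure.variation_add_le _)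

theorem tvNorm_smul (c : ℝ) (V : SignedMeasure X) : tvNorm (c • V) = |c| * tvNorm V := by
  simp only [tvNorm_eq_variation]
  rw [VectorMeasure.variation_smul]
  simp [measureReal_def]

theorem tvNorm_ofProb (P : ProbabilityMeasure X) : tvNorm (ofProb P) = 1 := by
  rw [tvNorm_eq_variation, ofProb, Measure.variation_toSignedMeasure]
  simp

theorem prod_add_left (V V' W : SignedMeasure X) :
    VectorMeasure.prod (V + V') W (ContinuousLinearMap.mul ℝ ℝ) =
      VectorMeasure.prod V W (ContinuousLinearMap.mul ℝ ℝ) +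
        VectorMeasure.prod V' W (ContinuousLinearMap.mul ℝ ℝ) := by
  apply VectorMeasure.prod_eq_of_forall_apply_prod
  intro s t _ _
  simp

theorem prod_add_right (V W W' : SignedMeasure X) :
    VectorMeasure.prod V (W + W') (ContinuousLinearMap.mul ℝ ℝ) =
      VectorMeasure.prod V W (ContinuousLinearMap.mul ℝ ℝ) +
        VectorMeasure.prod V W' (ContinuousLinearMap.mul ℝ ℝ) := by
  apply VectorMeasure.prod_eq_of_forall_apply_prod
  intro s t _ _
  simp [mul_add]

theorem prod_smul_left (c : ℝ) (V W : SignedMeasure X) :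
    VectorMeasure.prod (c • V) W (ContinuousLinearMap.mul ℝ ℝ) =
      c • VectorMeasure.prod V W (ContinuousLinearMap.mul ℝ ℝ) := by
  apply VectorMeasure.prod_eq_of_forall_apply_prod
  intro s t _ _
  simp [mul_assoc]

theorem prod_smul_right (c : ℝ) (V W : SignedMeasure X) :
    VectorMeasure.prod V (c • W) (ContinuousLinearMap.mul ℝ ℝ) =
      c • VectorMeasure.prod V W (ContinuousLinearMap.mul ℝ ℝ) := by
  apply VectorMeasure.prod_eq_of_forall_apply_prod
  intro s t _ _
  simp [mul_left_comm]

/-- Jordan decomposition. By bilinearity it reduces the ring axioms for `conv` to the known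
identities for positive measures. -/
theorem exists_eq_sub_toSignedMeasure (V : SignedMeasure X) :
    ∃ (μ ν : Measure X) (_ : IsFiniteMeasure μ) (_ : IsFiniteMeasure ν),
      V = μ.toSignedMeasure - ν.toSignedMeasure :=
  ⟨_, _, inferInstance, inferInstance, (V.toSignedMeasure_toJordanDecomposition).symm⟩

section Group

variable [AddCommGroup X]

theorem conv_add_left (V V' W : SignedMeasure X) : conv (V + V') W = conv V W + conv V' W := by
  rw [conv, prod_add_left, VectorMeasure.map_add]; rfl

theorem conv_add_right (V W W' : SignedMeasure X) : conv V (W + W') = conv V W + conv V W' := by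
  rw [conv, prod_add_right, VectorMeasure.map_add]; rfl

theorem conv_smul_left (c : ℝ) (V W : SignedMeasure X) : conv (c • V) W = c • conv V W := by
  rw [conv, prod_smul_left, VectorMeasure.map_smul]; rfl

theorem conv_smul_right (c : ℝ) (V W : SignedMeasure X) : conv V (c • W) = c • conv V W := by
  rw [conv, prod_smul_right, VectorMeasure.map_smul]; rfl

theorem conv_neg_left (V W : SignedMeasure X) : conv (-V) W = -conv V W := by
  rw [← neg_one_smul ℝ V, conv_smul_left]
  exact neg_one_smul ℝ (conv V W)

theorem conv_neg_right (V W : SignedMeasure X) : conv V (-W) = -conv V W := by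
  rw [← neg_one_smul ℝ W, conv_smul_right]
  exact neg_one_smul ℝ (conv V W)

theorem conv_sub_left (V V' W : SignedMeasure X) : conv (V - V') W = conv V W - conv V' W := by
  rw [sub_eq_add_neg, conv_add_left, conv_neg_left, ← sub_eq_add_neg]

theorem conv_sub_right (V W W' : SignedMeasure X) : conv V (W - W') = conv V W - conv V W' := by
  rw [sub_eq_add_neg, conv_add_right, conv_neg_right, ← sub_eq_add_neg]

theorem tvNorm_unit : tvNorm (unit : SignedMeasure X) = 1 := by
  rw [tvNorm_eq_variation, unit, Measure.variation_toSignedMeasure]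
  simp

/-- The variation of an image is at most the image of the variation, and |V ⊗ W| ≤ |V| ⊗ |W|. -/
theorem tvNorm_conv_le (V W : SignedMeasure X) : tvNorm (conv V W) ≤ tvNorm V * tvNorm W := by
  simp only [tvNorm_eq_variation, measureReal_def]
  rw [← ENNReal.toReal_mul]
  refine ENNReal.toReal_mono (by finiteness) ?_
  have h1 : (conv V W).variation Set.univ ≤
      ((VectorMeasure.prod V W (ContinuousLinearMap.mul ℝ ℝ)).variation.map
        fun x : X × X => x.1 + x.2) Set.univ := VectorMeasure.variation_map_le _
  refine h1.trans ?_
  by_cases hm : AEMeasurable (fun x : X × X => x.1 + x.2)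
      (VectorMeasure.prod V W (ContinuousLinearMap.mul ℝ ℝ)).variation
  · rw [Measure.map_apply_of_aemeasurable hm MeasurableSet.univ, Set.preimage_univ]
    refine (VectorMeasure.variation_prod_le _).trans ?_
    rw [Measure.smul_apply, ← Set.univ_prod_univ, Measure.prod_prod]
    have : ‖ContinuousLinearMap.mul ℝ ℝ‖ₑ ≤ 1 := by
      simp [enorm_eq_nnnorm]
    calc _ ≤ 1 * (V.variation Set.univ * W.variation Set.univ) := by
          rw [smul_eq_mul]; gcongr
      _ = _ := one_mul _
  -- Measurability of addition is not assumed here; a non-measurable push-forward is 0 by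
  -- convention.
  · rw [Measure.map_of_not_aemeasurable hm]; simp

variable [MeasurableSub₂ X]

instance measurableAdd₂_of_measurableSub₂ : MeasurableAdd₂ X := ⟨measurable_add_of_sub⟩

theorem conv_comm (V W : SignedMeasure X) : conv V W = conv W V := by
  obtain ⟨a, b, _, _, rfl⟩ := exists_eq_sub_toSignedMeasure V
  obtain ⟨c, d, _, _, rfl⟩ := exists_eq_sub_toSignedMeasure W
  have key (μ ν : Measure X) [IsFiniteMeasure μ] [IsFiniteMeasure ν] :
      conv μ.toSignedMeasure ν.toSignedMeasure = conv ν.toSignedMeasure μ.toSignedMeasure := by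
    rw [conv_toSignedMeasure, conv_toSignedMeasure]
    exact Measure.toSignedMeasure_congr (Measure.conv_comm _ _)
  simp only [conv_sub_left, conv_sub_right]
  rw [key a c, key a d, key b c, key b d]
  abel

theorem conv_assoc (U V W : SignedMeasure X) : conv (conv U V) W = conv U (conv V W) := by
  obtain ⟨a, b, _, _, rfl⟩ := exists_eq_sub_toSignedMeasure U
  obtain ⟨c, d, _, _, rfl⟩ := exists_eq_sub_toSignedMeasure V
  obtain ⟨e, f, _, _, rfl⟩ := exists_eq_sub_toSignedMeasure W
  have key (μ ν ρ : Measure X) [IsFiniteMeasure μ] [IsFiniteMeasure ν] [IsFiniteMeasure ρ] :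
      conv (conv μ.toSignedMeasure ν.toSignedMeasure) ρ.toSignedMeasure =
        conv μ.toSignedMeasure (conv ν.toSignedMeasure ρ.toSignedMeasure) := by
    simp only [conv_toSignedMeasure]
    exact Measure.toSignedMeasure_congr (Measure.conv_assoc _ _ _)
  simp only [conv_sub_left, conv_sub_right, key]

theorem unit_conv (V : SignedMeasure X) : conv unit V = V := by
  obtain ⟨a, b, _, _, rfl⟩ := exists_eq_sub_toSignedMeasure V
  simp only [conv_sub_right, unit, conv_toSignedMeasure]
  congr 1 <;> exact Measure.toSignedMeasure_congr (Measure.dirac_zero_conv _)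

/-- The convolution algebra of finite signed measures. -/
noncomputable instance convCommRing : CommRing (SignedMeasure X) where
  mul := conv
  one := unit
  left_distrib := conv_add_right
  right_distrib := conv_add_left
  zero_mul V := by
    have h := conv_smul_left 0 0 V
    rwa [zero_smul, zero_smul] at h
  mul_zero V := by
    have h := conv_smul_right 0 V 0
    rwa [zero_smul, zero_smul] at h
  mul_assoc := conv_assoc
  one_mul := unit_conv
  mul_one V := (conv_comm _ _).trans (unit_conv V)
  mul_comm := conv_comm
  neg_add_cancel := neg_add_cancel
  zsmul := (· • ·)
  zsmul_zero' := SubNegMonoid.zsmul_zero'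
  zsmul_succ' := SubNegMonoid.zsmul_succ'
  zsmul_neg' := SubNegMonoid.zsmul_neg'
  sub_eq_add_neg := sub_eq_add_neg

noncomputable instance convAlgebra : Algebra ℝ (SignedMeasure X) :=
  Algebra.ofModule conv_smul_left fun c V W => conv_smul_right c V W

theorem conv_eq_mul (V W : SignedMeasure X) : conv V W = V * W := rfl

theorem convPow_eq_pow (V : SignedMeasure X) (m : ℕ) : convPow V m = V ^ m := by
  induction m with
  | zero => rw [pow_zero]; rfl
  | succ m ih => rw [pow_succ, ← ih]; rfl

theorem convProd_eq_prod {n : ℕ} (L : Fin n → SignedMeasure X) (J : Finset (Fin n)) :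
    convProd L J = ∏ j ∈ J, L j := by
  have h : convProd L J = ((J.sort (· ≤ ·)).map L).prod := rfl
  rw [h, Finset.prod, ← Multiset.prod_coe, ← Multiset.map_coe, Finset.sort_eq]

end Group
-- Seminormed algebras and smoothing.
/-- A submultiplicative seminorm on a real algebra, with the unit of norm at most one. -/
structure IsAlgebraSeminorm {A : Type*} [CommRing A] [Algebra ℝ A] (N : A → ℝ) : Prop where
  add_le : ∀ a b, N (a + b) ≤ N a + N b
  smul : ∀ (c : ℝ) a, N (c • a) = |c| * N a
  mul_le : ∀ a b, N (a * b) ≤ N a * N b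
  one_le : N 1 ≤ 1

namespace IsAlgebraSeminorm

variable {A : Type*} [CommRing A] [Algebra ℝ A] {N : A → ℝ} (hN : IsAlgebraSeminorm N)
include hN

theorem zero : N 0 = 0 := by simpa using hN.smul 0 0

theorem neg (a : A) : N (-a) = N a := by simpa using hN.smul (-1) a

theorem nonneg (a : A) : 0 ≤ N a := by
  have h := hN.add_le a (-a)
  rw [add_neg_cancel, hN.zero, hN.neg] at h
  linarith

theorem sum_le {ι : Type*} (s : Finset ι) (f : ι → A) : N (∑ i ∈ s, f i) ≤ ∑ i ∈ s, N (f i) :=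
  Finset.le_sum_of_subadditive N hN.zero.le hN.add_le s f

theorem pow_le (a : A) (m : ℕ) : N (a ^ m) ≤ N a ^ m := by
  induction m with
  | zero => simpa using hN.one_le
  | succ m ih =>
    rw [pow_succ, pow_succ]
    exact (hN.mul_le _ _).trans (mul_le_mul_of_nonneg_right ih (hN.nonneg a))

theorem pow_le_one {a : A} (ha : N a ≤ 1) (m : ℕ) : N (a ^ m) ≤ 1 :=
  (hN.pow_le a m).trans (pow_le_one₀ (hN.nonneg a) ha)

theorem mul_le_left {a b : A} (hb : N b ≤ 1) : N (a * b) ≤ N a :=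
  (hN.mul_le a b).trans (mul_le_of_le_one_right (hN.nonneg a) hb)

theorem prod_le_one {ι : Type*} (s : Finset ι) (f : ι → A) (hf : ∀ i ∈ s, N (f i) ≤ 1) :
    N (∏ i ∈ s, f i) ≤ 1 := by
  classical
  induction s using Finset.induction_on with
  | empty => simpa using hN.one_le
  | insert i s hi ih =>
    rw [Finset.prod_insert hi]
    exact (hN.mul_le_left (ih fun j hj => hf j (Finset.mem_insert_of_mem hj))).trans
      (hf i (Finset.mem_insert_self i s))

theorem sum_smul_le_one {ι : Type*} [Fintype ι] {q : ι → ℝ} (hq : ∀ i, 0 ≤ q i)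
    (hq1 : ∑ i, q i = 1) {K : ι → A} (hK : ∀ i, N (K i) ≤ 1) : N (∑ i, q i • K i) ≤ 1 := by
  refine (hN.sum_le _ _).trans (hq1 ▸ Finset.sum_le_sum fun i _ => ?_)
  rw [hN.smul, abs_of_nonneg (hq i)]
  exact mul_le_of_le_one_right (hq i) (hK i)

/-- The law of the sum of `m + 1` independent copies of `ξ`, jointly with the product of the
corresponding factors. -/
theorem exists_weights {ι : Type} [Fintype ι] {q ξ : ι → ℝ} (hq : ∀ i, 0 ≤ q i)
    (hq1 : ∑ i, q i = 1) (hξ : ∑ i, q i * ξ i = 0) {K : ι → A} (hK : ∀ i, N (K i) ≤ 1) (m : ℕ) :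
    ∃ (κ : Type) (_ : Fintype κ) (w S : κ → ℝ) (L : κ → A), (∀ i, 0 ≤ w i) ∧ ∑ i, w i = 1 ∧
      ∑ i, w i * S i = 0 ∧ ∑ i, w i * S i ^ 2 = (m + 1) * ∑ i, q i * ξ i ^ 2 ∧
      (∀ i, N (L i) ≤ 1) ∧ ∑ i, w i • L i = (∑ i, q i • K i) ^ (m + 1) ∧
      ∑ i, (w i * S i) • L i =
        ((m : ℝ) + 1) • ((∑ i, (q i * ξ i) • K i) * (∑ i, q i • K i) ^ m) := by
  induction m with
  | zero => exact ⟨ι, inferInstance, q, ξ, K, hq, hq1, hξ, by simp, hK, by simp, by simp⟩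
  | succ m ih =>
    obtain ⟨κ, _, w, S, L, hw, hw1, hS, hS2, hL, hG, hD⟩ := ih
    refine ⟨κ × ι, inferInstance, fun i => w i.1 * q i.2, fun i => S i.1 + ξ i.2,
      fun i => L i.1 * K i.2, fun i => mul_nonneg (hw _) (hq _), ?_, ?_, ?_, fun i =>
      (hN.mul_le_left (hK _)).trans (hL _), ?_, ?_⟩
    · simp_rw [Fintype.sum_prod_type, ← Finset.mul_sum, ← Finset.sum_mul, hw1, hq1, one_mul]
    · have h (i : κ × ι) : w i.1 * q i.2 * (S i.1 + ξ i.2) =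
          w i.1 * S i.1 * q i.2 + w i.1 * (q i.2 * ξ i.2) := by ring
      simp_rw [h, Finset.sum_add_distrib, Fintype.sum_prod_type, ← Finset.mul_sum,
        ← Finset.sum_mul, hξ, hS]
      simp
    -- Variances of independent centred variables add: the cross term vanishes.
    · have h (i : κ × ι) : w i.1 * q i.2 * (S i.1 + ξ i.2) ^ 2 = w i.1 * S i.1 ^ 2 * q i.2 +
          2 * (w i.1 * S i.1) * (q i.2 * ξ i.2) + w i.1 * (q i.2 * ξ i.2 ^ 2) := by ring
      simp_rw [h, Finset.sum_add_distrib, Fintype.sum_prod_type, ← Finset.mul_sum,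
        ← Finset.sum_mul, hξ, hS2, hq1, hw1]
      push_cast
      ring
    · have h (i : κ × ι) : (w i.1 * q i.2) • (L i.1 * K i.2) = (w i.1 • L i.1) * (q i.2 • K i.2) :=
        (smul_mul_smul_comm _ _ _ _).symm
      simp_rw [h, Fintype.sum_prod_type, ← Finset.mul_sum, ← Finset.sum_mul, hG]
      rw [pow_succ _ (m + 1)]
    · have h (i : κ × ι) : (w i.1 * q i.2 * (S i.1 + ξ i.2)) • (L i.1 * K i.2) =
          ((w i.1 * S i.1) • L i.1) * (q i.2 • K i.2) +
            (w i.1 • L i.1) * ((q i.2 * ξ i.2) • K i.2) := by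
        rw [smul_mul_smul_comm, smul_mul_smul_comm, ← add_smul]
        congr 1
        ring
      simp_rw [h, Finset.sum_add_distrib, Fintype.sum_prod_type, ← Finset.mul_sum,
        ← Finset.sum_mul, hG, hD]
      push_cast
      simp only [Algebra.smul_def, map_add, map_one]
      ring

/-- Put ξ = δ/q, a centred variable under the weights q, and let S be the sum of m + 1 independent
copies. By symmetry (m + 1) D G^m is the mean of S L, where L is the product of the corresponding
K's. Its norm is at most E|S| ≤ √(Var S), and Var S = (m + 1) Var ξ. -/
theorem sq_sum_smul_mul_pow_le {ι : Type} [Fintype ι] {q δ : ι → ℝ} (hq : ∀ i, 0 < q i)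
    (hq1 : ∑ i, q i = 1) (hδ : ∑ i, δ i = 0) {K : ι → A} (hK : ∀ i, N (K i) ≤ 1) (m : ℕ) :
    N ((∑ i, δ i • K i) * (∑ i, q i • K i) ^ m) ^ 2 ≤ (∑ i, δ i ^ 2 / q i) / (m + 1) := by
  have hqδ (i : ι) : q i * (δ i / q i) = δ i := mul_div_cancel₀ _ (hq i).ne'
  obtain ⟨κ, _, w, S, L, hw, hw1, hS, hS2, hL, hG, hD⟩ :=
    hN.exists_weights (ξ := fun i => δ i / q i) (fun i => (hq i).le) hq1 (by simpa [hqδ]) hK m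
  simp only [hqδ] at hD
  have hm : (0 : ℝ) < m + 1 := by positivity
  have h1 : (m + 1 : ℝ) * N ((∑ i, δ i • K i) * (∑ i, q i • K i) ^ m) ≤ ∑ i, w i * |S i| := by
    rw [← abs_of_pos hm, ← hN.smul, ← hD]
    refine (hN.sum_le _ _).trans (Finset.sum_le_sum fun i _ => ?_)
    rw [hN.smul, abs_mul, abs_of_nonneg (hw i)]
    exact mul_le_of_le_one_right (by have := hw i; positivity) (hL i)
  have h2 : (∑ i, w i * |S i|) ^ 2 ≤ ∑ i, w i * S i ^ 2 := by
    have := Finset.sum_sq_le_sum_mul_sum_of_sq_le_mul Finset.univ (r := fun i => w i * |S i|)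
      (f := w) (g := fun i => w i * S i ^ 2) (fun i _ => hw i)
      (fun i _ => mul_nonneg (hw i) (sq_nonneg _))
      (fun i _ => by rw [mul_pow, sq_abs]; exact le_of_eq (by ring))
    rwa [hw1, one_mul] at this
  have h3 : ∑ i, q i * (δ i / q i) ^ 2 = ∑ i, δ i ^ 2 / q i :=
    Finset.sum_congr rfl fun i _ => by have := (hq i).ne'; field_simp
  rw [hS2, h3] at h2
  have h4 := pow_le_pow_left₀ (mul_nonneg hm.le (hN.nonneg _)) h1 2
  rw [le_div_iff₀ hm]
  refine le_of_mul_le_mul_left ?_ hm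
  calc _ = ((m + 1 : ℝ) * N ((∑ i, δ i • K i) * (∑ i, q i • K i) ^ m)) ^ 2 := by ring
    _ ≤ _ := h4.trans h2

end IsAlgebraSeminorm
-- Power series majorants for elementary symmetric functions.
-- In other words c₁ ≤ 7/10. Taylor polynomials settle x ≤ 1, monotonicity of the difference settles
-- x ≥ 1.
theorem two_sub_mul_exp_le (x : ℝ) (hx : 0 ≤ x) :
    2 - (1 - x) * Real.exp x ≤ Real.exp (7 / 10 * x ^ 2) := by
  rcases le_total x 1 with hx1 | hx1
  · have h1 := Real.sum_le_exp_of_nonneg hx 8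
    have h2 := Real.sum_le_exp_of_nonneg (x := 7 / 10 * x ^ 2) (by positivity) 5
    simp only [Finset.sum_range_succ, Finset.sum_range_zero, Nat.factorial] at h1 h2
    have h3 := mul_le_mul_of_nonneg_left h1 (sub_nonneg.2 hx1)
    refine ((sub_le_sub_left h3 2).trans ?_).trans h2
    -- The difference of the two polynomials through degree 6, with the coefficient of x^6 rounded
    -- down; the rest of that coefficient absorbs the x^7 term.
    have h5 : 0 ≤ x ^ 2 * (1 / 5 - x / 3 + 3 / 25 * x ^ 2 - x ^ 3 / 30 + 49 / 1000 * x ^ 4) :=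
      mul_nonneg (sq_nonneg x)
        (by nlinarith [sq_nonneg (x ^ 2 - 34 / 100 * x - 6 / 10), sq_nonneg (x - 51 / 50)])
    have h6 : x ^ 7 ≤ x ^ 6 := pow_le_pow_of_le_one hx hx1 (by norm_num)
    have h7 : 0 ≤ x ^ 8 := by positivity
    have h8 : 0 ≤ x ^ 6 := by positivity
    norm_num
    nlinarith
  · have hd (y : ℝ) : HasDerivAt (fun y : ℝ => Real.exp (7 / 10 * y ^ 2) + (1 - y) * Real.exp y)
        (Real.exp (7 / 10 * y ^ 2) * (7 / 5 * y) - y * Real.exp y) y := by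
      have h1 : HasDerivAt (fun y : ℝ => 7 / 10 * y ^ 2) (7 / 5 * y) y := by
        refine ((hasDerivAt_pow 2 y).const_mul (7 / 10 : ℝ)).congr_deriv ?_
        norm_num
        ring
      refine (h1.exp.add (((hasDerivAt_id' y).const_sub 1).mul
        (Real.hasDerivAt_exp y))).congr_deriv ?_
      ring
    have hmono : MonotoneOn (fun y : ℝ => Real.exp (7 / 10 * y ^ 2) + (1 - y) * Real.exp y)
        (Set.Ici 1) := by
      refine monotoneOn_of_deriv_nonneg (convex_Ici 1)
        (fun y _ => (hd y).continuousAt.continuousWithinAt)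
        (fun y _ => (hd y).differentiableAt.differentiableWithinAt) fun y hy => ?_
      rw [interior_Ici, Set.mem_Ioi] at hy
      rw [(hd y).deriv]
      -- For y ≥ 1 one has y ≤ 7/10 y² + 3/10, and exp(3/10) ≤ 7/5.
      have h1 : Real.exp y ≤ Real.exp (7 / 10 * y ^ 2) * (7 / 5) := by
        have h2 : Real.exp y ≤ Real.exp (7 / 10 * y ^ 2 + 3 / 10) :=
          Real.exp_le_exp.2 (by nlinarith)
        rw [Real.exp_add] at h2
        refine h2.trans (mul_le_mul_of_nonneg_left ?_ (Real.exp_pos _).le)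
        have := Real.exp_bound' (x := 3 / 10) (by norm_num) (by norm_num) (n := 4) (by norm_num)
        refine this.trans ?_
        norm_num [Finset.sum_range_succ, Nat.factorial]
      nlinarith
    have h1 := hmono Set.self_mem_Ici hx1 hx1
    have h2 := Real.sum_le_exp_of_nonneg (x := 7 / 10) (by norm_num) 5
    norm_num [Finset.sum_range_succ, Nat.factorial] at h1 h2
    linarith

/-- The absolute value of the coefficient of `x ^ m` in `(1 + x) * exp (-x)`. -/
noncomputable def twistCoeff (m : ℕ) : ℝ := |(m : ℝ) - 1| / m.factorial

theorem twistCoeff_nonneg (m : ℕ) : 0 ≤ twistCoeff m := by unfold twistCoeff; positivity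

theorem hasSum_twistCoeff (y : ℝ) :
    HasSum (fun m => twistCoeff m * y ^ m) (2 - (1 - y) * Real.exp y) := by
  have h1 : HasSum (fun m : ℕ => y ^ m / (m.factorial : ℝ)) (Real.exp y) := by
    rw [Real.exp_eq_exp_ℝ]; exact NormedSpace.expSeries_div_hasSum_exp y
  have h2 : HasSum (fun m : ℕ => (m : ℝ) * (y ^ m / (m.factorial : ℝ))) (y * Real.exp y) := by
    rw [← hasSum_nat_add_iff' 1]
    simp only [Finset.range_one, Finset.sum_singleton, Nat.cast_zero, zero_mul, sub_zero]
    refine (h1.mul_left y).congr_fun fun m => ?_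
    rw [Nat.factorial_succ, pow_succ]
    push_cast
    field_simp
  have h3 : HasSum (fun m : ℕ => if m = 0 then (2 : ℝ) else 0) 2 := hasSum_ite_eq 0 2
  have h4 : 2 - (1 - y) * Real.exp y = 2 + y * Real.exp y - Real.exp y := by ring
  rw [h4]
  refine ((h3.add h2).sub h1).congr_fun fun m => ?_
  rcases m with _ | m
  · norm_num [twistCoeff]
  · simp only [twistCoeff, Nat.cast_add, Nat.cast_one, add_sub_cancel_right, Nat.abs_cast,
      Nat.succ_ne_zero, if_false]
    field_simp
    ring

/-- The power series `1 + ∑_{m ≥ 2} (m - 1) / m! * x ^ m * z ^ m` in `z`. -/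
noncomputable def twistSeries (x : ℝ) : PowerSeries ℝ :=
  PowerSeries.mk fun m => twistCoeff m * x ^ m

/-- The coefficients of the power series in `z` of `exp (a * z ^ 2 / 2 + b * z ^ 3 / 3)`. -/
noncomputable def expCoeff (a b : ℝ) : ℕ → ℝ
  | 0 => 1
  | 1 => 0
  | 2 => a / 2
  | m + 3 => (a * expCoeff a b (m + 1) + b * expCoeff a b m) / (m + 3)

theorem expCoeff_mono {a b a' b' : ℝ} (ha : 0 ≤ a) (hb : 0 ≤ b) (haa : a ≤ a') (hbb : b ≤ b')
    (m : ℕ) : 0 ≤ expCoeff a b m ∧ expCoeff a b m ≤ expCoeff a' b' m := by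
  induction m using Nat.strong_induction_on with
  | _ m ih =>
    match m with
    | 0 => simp [expCoeff]
    | 1 => simp [expCoeff]
    | 2 => simp only [expCoeff]; constructor <;> linarith
    | m + 3 =>
      obtain ⟨h1, h2⟩ := ih m (by omega)
      obtain ⟨h3, h4⟩ := ih (m + 1) (by omega)
      simp only [expCoeff]
      constructor
      · positivity
      · have := ha.trans haa
        have := hb.trans hbb
        gcongr

theorem expCoeff_pow (x : ℝ) (m : ℕ) : expCoeff (x ^ 2) (x ^ 3) m = expCoeff 1 1 m * x ^ m := by
  induction m using Nat.strong_induction_on with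
  | _ m ih =>
    match m with
    | 0 => simp [expCoeff]
    | 1 => simp [expCoeff]
    | 2 => simp only [expCoeff]; ring
    | m + 3 =>
      simp only [expCoeff]
      rw [ih m (by omega), ih (m + 1) (by omega)]
      ring

/-- Replaces the twisted series by an exponential, for which products over j become sums in the
exponent; the two agree through degree 4. The induction checks that `twistCoeff` satisfies the
recurrence of `expCoeff` as an inequality. -/
theorem twistCoeff_le_expCoeff (m : ℕ) : twistCoeff m ≤ expCoeff 1 1 m := by
  induction m using Nat.strong_induction_on with
  | _ m ih =>
    match m with
    | 0 => simp [expCoeff, twistCoeff]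
    | 1 => simp [expCoeff, twistCoeff]
    | 2 => norm_num [expCoeff, twistCoeff, Nat.factorial]
    | 3 => norm_num [expCoeff, twistCoeff, Nat.factorial]
    | m + 4 =>
      have h1 := ih (m + 1) (by omega)
      have h2 := ih (m + 2) (by omega)
      rw [expCoeff, le_div_iff₀ (by positivity)]
      have hm : (0 : ℝ) ≤ m := m.cast_nonneg
      refine le_trans ?_ (add_le_add (mul_le_mul_of_nonneg_left h2 zero_le_one)
        (mul_le_mul_of_nonneg_left h1 zero_le_one))
      have e4 : ((m + 4).factorial : ℝ) = (m + 4) * ((m + 3) * ((m + 2) * (m + 1).factorial)) := by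
        simp only [Nat.factorial_succ]; push_cast; ring
      have e2 : ((m + 2).factorial : ℝ) = (m + 2) * (m + 1).factorial := by
        simp only [Nat.factorial_succ]; push_cast; ring
      have hf : (0 : ℝ) < (m + 1).factorial := by positivity
      simp only [twistCoeff, e4, e2]
      push_cast
      rw [abs_of_nonneg (by linarith), abs_of_nonneg (by linarith), abs_of_nonneg (by linarith)]
      rw [← sub_nonneg]
      have : 1 * (((m : ℝ) + 2 - 1) / ((m + 2) * (m + 1).factorial)) +
          1 * (((m : ℝ) + 1 - 1) / (m + 1).factorial) -
          ((m : ℝ) + 4 - 1) / ((m + 4) * ((m + 3) * ((m + 2) * (m + 1).factorial))) *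
            ((m + 1 : ℕ) + 3) =
          (m * (m + 3)) / ((m + 2) * (m + 1).factorial) := by
        push_cast
        field_simp
        ring
      push_cast at this
      rw [this]
      positivity

/-- `f` is the power series of `exp (a * z ^ 2 / 2 + b * z ^ 3 / 3)`. -/
structure IsExpSeries (a b : ℝ) (f : PowerSeries ℝ) : Prop where
  coeff_zero : PowerSeries.coeff 0 f = 1
  derivative : PowerSeries.derivative ℝ f =
    (PowerSeries.C a * PowerSeries.X + PowerSeries.C b * PowerSeries.X ^ 2) * f

theorem isExpSeries_mk (a b : ℝ) : IsExpSeries a b (PowerSeries.mk (expCoeff a b)) where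
  coeff_zero := by simp [expCoeff]
  derivative := by
    ext m
    rw [PowerSeries.coeff_derivative, add_mul, map_add, mul_assoc, mul_assoc,
      PowerSeries.coeff_C_mul, PowerSeries.coeff_C_mul, PowerSeries.coeff_mk]
    rcases m with _ | _ | m
    · simp [expCoeff]
    · rw [PowerSeries.coeff_succ_X_mul, pow_two, mul_assoc, PowerSeries.coeff_succ_X_mul]
      simp [expCoeff]; ring
    · rw [PowerSeries.coeff_succ_X_mul, pow_two, mul_assoc, PowerSeries.coeff_succ_X_mul,
        PowerSeries.coeff_succ_X_mul, PowerSeries.coeff_mk, PowerSeries.coeff_mk, expCoeff]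
      push_cast
      field_simp
      ring

theorem IsExpSeries.mul {a b a' b' : ℝ} {f g : PowerSeries ℝ} (hf : IsExpSeries a b f)
    (hg : IsExpSeries a' b' g) : IsExpSeries (a + a') (b + b') (f * g) where
  coeff_zero := by
    rw [PowerSeries.coeff_mul]
    simp [-PowerSeries.coeff_zero_eq_constantCoeff, hf.coeff_zero, hg.coeff_zero]
  derivative := by
    rw [Derivation.leibniz, hf.derivative, hg.derivative, map_add, map_add, smul_eq_mul,
      smul_eq_mul]
    ring

theorem IsExpSeries.prod {ι : Type*} (s : Finset ι) {a b : ι → ℝ} {f : ι → PowerSeries ℝ}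
    (hf : ∀ i ∈ s, IsExpSeries (a i) (b i) (f i)) :
    IsExpSeries (∑ i ∈ s, a i) (∑ i ∈ s, b i) (∏ i ∈ s, f i) := by
  classical
  induction s using Finset.induction_on with
  | empty => exact ⟨by simp, by simp⟩
  | insert i s hi ih =>
    rw [Finset.prod_insert hi, Finset.sum_insert hi, Finset.sum_insert hi]
    exact (hf i (Finset.mem_insert_self i s)).mul
      (ih fun j hj => hf j (Finset.mem_insert_of_mem hj))

/-- Uniqueness for the differential equation f' = (a z + b z²) f with f(0) = 1. -/
theorem IsExpSeries.coeff_eq {a b : ℝ} {f : PowerSeries ℝ} (hf : IsExpSeries a b f) (m : ℕ) :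
    PowerSeries.coeff m f = expCoeff a b m := by
  have h (m : ℕ) := congrArg (PowerSeries.coeff m) hf.derivative
  simp only [PowerSeries.coeff_derivative, add_mul, map_add, mul_assoc,
    PowerSeries.coeff_C_mul, pow_two] at h
  induction m using Nat.strong_induction_on with
  | _ m ih =>
    match m with
    | 0 => simpa [expCoeff] using hf.coeff_zero
    | 1 => simpa [expCoeff] using h 0
    | 2 =>
      have h1 := h 1
      rw [PowerSeries.coeff_succ_X_mul, PowerSeries.coeff_succ_X_mul, hf.coeff_zero] at h1
      simp at h1
      rw [expCoeff]
      linarith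
    | m + 3 =>
      have h1 := h (m + 2)
      rw [PowerSeries.coeff_succ_X_mul, PowerSeries.coeff_succ_X_mul,
        PowerSeries.coeff_succ_X_mul, ih m (by omega), ih (m + 1) (by omega)] at h1
      rw [expCoeff, eq_div_iff (by positivity), ← h1]
      push_cast
      ring

/-- The norms of the coefficients of `f` are bounded by the coefficients of `g`. -/
def IsMajorant {A : Type*} [CommRing A] (N : A → ℝ) (f : PowerSeries A) (g : PowerSeries ℝ) :
    Prop := ∀ m, N (PowerSeries.coeff m f) ≤ PowerSeries.coeff m g

namespace IsAlgebraSeminorm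

variable {A : Type*} [CommRing A] [Algebra ℝ A] {N : A → ℝ} (hN : IsAlgebraSeminorm N)
include hN

theorem isMajorant_mul {f f' : PowerSeries A} {g g' : PowerSeries ℝ} (h : IsMajorant N f g)
    (h' : IsMajorant N f' g') : IsMajorant N (f * f') (g * g') := by
  intro m
  rw [PowerSeries.coeff_mul, PowerSeries.coeff_mul]
  refine (hN.sum_le _ _).trans (Finset.sum_le_sum fun i _ => (hN.mul_le _ _).trans ?_)
  exact mul_le_mul (h _) (h' _) (hN.nonneg _) ((hN.nonneg _).trans (h _))

theorem isMajorant_one : IsMajorant N 1 1 := by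
  intro m
  rw [PowerSeries.coeff_one, PowerSeries.coeff_one]
  split_ifs
  · exact hN.one_le
  · exact hN.zero.le

theorem isMajorant_prod {ι : Type*} (s : Finset ι) {f : ι → PowerSeries A}
    {g : ι → PowerSeries ℝ} (h : ∀ i ∈ s, IsMajorant N (f i) (g i)) :
    IsMajorant N (∏ i ∈ s, f i) (∏ i ∈ s, g i) := by
  classical
  induction s using Finset.induction_on with
  | empty => simpa using hN.isMajorant_one
  | insert i s hi ih =>
    rw [Finset.prod_insert hi, Finset.prod_insert hi]
    exact hN.isMajorant_mul (h i (Finset.mem_insert_self i s))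
      (ih fun j hj => h j (Finset.mem_insert_of_mem hj))

/-- The coefficient of z^m in (1 + a z) exp(-a z) is ± `twistCoeff m` times a^m. -/
theorem isMajorant_twistSeries [Algebra ℚ A] (a : A) :
    IsMajorant N ((1 + PowerSeries.C a * PowerSeries.X) *
      PowerSeries.rescale (-a) (PowerSeries.exp A)) (twistSeries (N a)) := by
  intro m
  -- The ℚ-algebra structure required by `PowerSeries.exp` agrees with the real one, since ring
  -- homomorphisms out of ℚ are unique.
  have hmap (c : ℚ) : algebraMap ℚ A c = algebraMap ℝ A c :=
    (RingHom.congr_fun (RingHom.ext_rat (algebraMap ℚ A)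
      ((algebraMap ℝ A).comp (Rat.castHom ℝ))) c)
  have key : PowerSeries.coeff m ((1 + PowerSeries.C a * PowerSeries.X) *
      PowerSeries.rescale (-a) (PowerSeries.exp A)) =
      ((-1) ^ m * ((1 - m) / m.factorial) : ℝ) • a ^ m := by
    rw [add_mul, one_mul, map_add, mul_assoc, PowerSeries.coeff_C_mul, PowerSeries.coeff_rescale,
      PowerSeries.coeff_exp]
    rcases m with _ | m
    · simp
    · rw [PowerSeries.coeff_succ_X_mul, PowerSeries.coeff_rescale, PowerSeries.coeff_exp,
        hmap, hmap, Algebra.smul_def]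
      have h1 : (((1 / m.factorial : ℚ) : ℝ)) = (m + 1) * (1 / (m + 1).factorial) := by
        rw [Nat.factorial_succ]; push_cast; field_simp
      have h2 : (((-1) ^ (m + 1) * ((1 - (m + 1 : ℕ)) / (m + 1).factorial) : ℝ)) =
          (-1) ^ (m + 1) * (-m * (1 / (m + 1).factorial)) := by
        push_cast; ring
      rw [h1, h2, neg_pow a, neg_pow a]
      push_cast
      ring
  rw [key, hN.smul, twistSeries, PowerSeries.coeff_mk, abs_mul, abs_pow, abs_neg, abs_one,
    one_pow, one_mul, abs_div, Nat.abs_cast, abs_sub_comm, twistCoeff]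
  gcongr
  exact hN.pow_le a m

/-- The symmetric function is the coefficient of z^k in ∏ (1 + M_j z). As ∑ M_j = 0, inserting the
factors exp(-M_j z) changes nothing, but it removes the linear term of each factor before norms are
taken. -/
theorem esymm_le_coeff {n : ℕ} {M : Fin n → A} (hM : ∑ j, M j = 0) (k : ℕ) :
    N (∑ J ∈ (Finset.univ : Finset (Fin n)).powersetCard k, ∏ j ∈ J, M j) ≤
      PowerSeries.coeff k (∏ j, twistSeries (N (M j))) := by
  let _ : Algebra ℚ A := Algebra.compHom A (algebraMap ℚ ℝ)
  have hexp (s : Finset (Fin n)) : ∏ j ∈ s, PowerSeries.rescale (-M j) (PowerSeries.exp A) =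
      PowerSeries.rescale (-∑ j ∈ s, M j) (PowerSeries.exp A) := by
    classical
    induction s using Finset.induction_on with
    | empty => simp
    | insert i s hi ih =>
      rw [Finset.prod_insert hi, Finset.sum_insert hi, ih, PowerSeries.exp_mul_exp_eq_exp_add,
        neg_add]
  have h := hN.isMajorant_prod Finset.univ (fun j _ => hN.isMajorant_twistSeries (M j)) k
  rw [Finset.prod_mul_distrib, hexp, hM] at h
  convert h using 2
  rw [neg_zero, PowerSeries.rescale_zero]
  simp only [RingHom.comp_apply, PowerSeries.constantCoeff_exp, map_one, mul_one]
  rw [Finset.prod_one_add, map_sum]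
  simp_rw [Finset.prod_mul_distrib, Finset.prod_const, ← map_prod, PowerSeries.coeff_C_mul,
    PowerSeries.coeff_X_pow, mul_ite, mul_one, mul_zero]
  rw [← Finset.sum_filter]
  refine Finset.sum_congr ?_ fun _ _ => rfl
  ext J
  simp [eq_comm]

end IsAlgebraSeminorm

/-- Cauchy's estimate for nonnegative coefficients: a single term is at most the sum of the series
at R. -/
theorem coeff_mul_pow_le_prod {ι : Type*} (s : Finset ι) {f : ι → PowerSeries ℝ} {R : ℝ}
    (hR : 0 ≤ R) {B : ι → ℝ} (hf : ∀ i ∈ s, ∀ m, 0 ≤ PowerSeries.coeff m (f i))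
    (hB : ∀ i ∈ s, HasSum (fun m => PowerSeries.coeff m (f i) * R ^ m) (B i)) (k : ℕ) :
    PowerSeries.coeff k (∏ i ∈ s, f i) * R ^ k ≤ ∏ i ∈ s, B i := by
  classical
  have key : (∀ m, 0 ≤ PowerSeries.coeff m (∏ i ∈ s, f i)) ∧
      HasSum (fun m => PowerSeries.coeff m (∏ i ∈ s, f i) * R ^ m) (∏ i ∈ s, B i) := by
    induction s using Finset.induction_on with
    | empty =>
      simp only [Finset.prod_empty, PowerSeries.coeff_one]
      refine ⟨fun m => by split_ifs <;> norm_num, ?_⟩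
      convert hasSum_ite_eq (0 : ℕ) (1 : ℝ) using 2 with m
      split_ifs with h <;> simp [h]
    | insert i s hi ih =>
      obtain ⟨h1, h2⟩ := ih (fun j hj => hf j (Finset.mem_insert_of_mem hj))
        (fun j hj => hB j (Finset.mem_insert_of_mem hj))
      have h3 := hf i (Finset.mem_insert_self i s)
      have h4 := hB i (Finset.mem_insert_self i s)
      rw [Finset.prod_insert hi, Finset.prod_insert hi]
      refine ⟨fun m => ?_, ?_⟩
      · rw [PowerSeries.coeff_mul]
        exact Finset.sum_nonneg fun p _ => mul_nonneg (h3 _) (h1 _)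
      · have n1 : Summable fun m => ‖PowerSeries.coeff m (f i) * R ^ m‖ := h4.summable.norm
        have n2 : Summable fun m => ‖PowerSeries.coeff m (∏ j ∈ s, f j) * R ^ m‖ :=
          h2.summable.norm
        have h5 := (summable_norm_sum_mul_antidiagonal_of_summable_norm n1 n2).of_norm.hasSum
        rw [← tsum_mul_tsum_eq_tsum_sum_antidiagonal_of_summable_norm n1 n2, h4.tsum_eq,
          h2.tsum_eq] at h5
        refine h5.congr_fun fun m => ?_
        rw [PowerSeries.coeff_mul, Finset.sum_mul]
        refine Finset.sum_congr rfl fun p hp => ?_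
        rw [← Finset.HasAntidiagonal.mem_antidiagonal.1 hp, pow_add]
        ring
  exact le_hasSum key.2 k fun m _ => mul_nonneg (key.1 m) (pow_nonneg hR m)

theorem coeff_prod_mono {ι : Type*} (s : Finset ι) {f g : ι → PowerSeries ℝ}
    (hf : ∀ i ∈ s, ∀ m, 0 ≤ PowerSeries.coeff m (f i))
    (hfg : ∀ i ∈ s, ∀ m, PowerSeries.coeff m (f i) ≤ PowerSeries.coeff m (g i)) (k : ℕ) :
    PowerSeries.coeff k (∏ i ∈ s, f i) ≤ PowerSeries.coeff k (∏ i ∈ s, g i) := by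
  have hN : IsAlgebraSeminorm (fun x : ℝ => |x|) :=
    ⟨abs_add_le, fun c a => by rw [smul_eq_mul, abs_mul], fun a b => (abs_mul a b).le, by simp⟩
  refine (le_abs_self _).trans (hN.isMajorant_prod s (fun i hi m => ?_) k)
  beta_reduce
  rw [abs_of_nonneg (hf i hi m)]
  exact hfg i hi m

theorem sum_cube_le {ι : Type*} (s : Finset ι) {x : ι → ℝ} {r : ℝ}
    (hr : 0 ≤ r) (h : ∑ i ∈ s, x i ^ 2 ≤ r ^ 2) : ∑ i ∈ s, x i ^ 3 ≤ r ^ 3 := by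
  have hxr (i) (hi : i ∈ s) : x i ≤ r := by
    have := (Finset.single_le_sum (fun j _ => sq_nonneg (x j)) hi).trans h
    exact le_of_sq_le_sq this hr
  calc ∑ i ∈ s, x i ^ 3 ≤ ∑ i ∈ s, r * x i ^ 2 := Finset.sum_le_sum fun i hi => by
        have := mul_le_mul_of_nonneg_right (hxr i hi) (sq_nonneg (x i)); linarith
    _ = r * ∑ i ∈ s, x i ^ 2 := by rw [Finset.mul_sum]
    _ ≤ r * r ^ 2 := by gcongr
    _ = r ^ 3 := by ring

namespace IsAlgebraSeminorm

variable {A : Type*} [CommRing A] [Algebra ℝ A] {N : A → ℝ} (hN : IsAlgebraSeminorm N)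
include hN

/-- The product of the majorants is exp(a z²/2 + b z³/3) with a = ∑ N(M_j)² ≤ r² and b = ∑ N(M_j)³ ≤
r³. -/
theorem esymm_le_expCoeff {n : ℕ} {M : Fin n → A} (hM : ∑ j, M j = 0) {r : ℝ} (hr : 0 ≤ r)
    (h : ∑ j, N (M j) ^ 2 ≤ r ^ 2) (k : ℕ) :
    N (∑ J ∈ (Finset.univ : Finset (Fin n)).powersetCard k, ∏ j ∈ J, M j) ≤
      expCoeff 1 1 k * r ^ k := by
  refine (hN.esymm_le_coeff hM k).trans ?_
  have h1 : PowerSeries.coeff k (∏ j, twistSeries (N (M j))) ≤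
      PowerSeries.coeff k (∏ j, PowerSeries.mk (expCoeff (N (M j) ^ 2) (N (M j) ^ 3))) := by
    refine coeff_prod_mono _ (fun j _ m => ?_) (fun j _ m => ?_) k
    · rw [twistSeries, PowerSeries.coeff_mk]
      exact mul_nonneg (twistCoeff_nonneg m) (pow_nonneg (hN.nonneg _) m)
    · rw [twistSeries, PowerSeries.coeff_mk, PowerSeries.coeff_mk, expCoeff_pow]
      exact mul_le_mul_of_nonneg_right (twistCoeff_le_expCoeff m) (pow_nonneg (hN.nonneg _) m)
  refine h1.trans ?_
  rw [(IsExpSeries.prod Finset.univ fun j _ => isExpSeries_mk _ _).coeff_eq, ← expCoeff_pow]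
  exact (expCoeff_mono (Finset.sum_nonneg fun j _ => sq_nonneg _)
    (Finset.sum_nonneg fun j _ => pow_nonneg (hN.nonneg _) 3) h
    (sum_cube_le _ hr h) k).2

theorem esymm_mul_pow_le_exp {n : ℕ} {M : Fin n → A} (hM : ∑ j, M j = 0) {R : ℝ} (hR : 0 ≤ R)
    (k : ℕ) :
    N (∑ J ∈ (Finset.univ : Finset (Fin n)).powersetCard k, ∏ j ∈ J, M j) * R ^ k ≤
      Real.exp (7 / 10 * (R ^ 2 * ∑ j, N (M j) ^ 2)) := by
  refine (mul_le_mul_of_nonneg_right (hN.esymm_le_coeff hM k) (pow_nonneg hR k)).trans ?_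
  refine (coeff_mul_pow_le_prod _ hR (B := fun j => 2 - (1 - N (M j) * R) * Real.exp (N (M j) * R))
    (fun j _ m => ?_) (fun j _ => ?_) k).trans ?_
  · rw [twistSeries, PowerSeries.coeff_mk]
    exact mul_nonneg (twistCoeff_nonneg m) (pow_nonneg (hN.nonneg _) m)
  · convert hasSum_twistCoeff (N (M j) * R) using 2 with m
    rw [twistSeries, PowerSeries.coeff_mk, mul_pow, mul_assoc]
  · rw [Finset.mul_sum, Finset.mul_sum, Real.exp_sum]
    refine Finset.prod_le_prod (fun j _ => ?_) fun j _ => ?_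
    · exact (hasSum_twistCoeff (N (M j) * R)).nonneg fun m =>
        mul_nonneg (twistCoeff_nonneg m) (pow_nonneg (mul_nonneg (hN.nonneg _) hR) m)
    · refine (two_sub_mul_exp_le _ (mul_nonneg (hN.nonneg _) hR)).trans_eq ?_
      congr 1
      ring

end IsAlgebraSeminorm
-- Expansion around the mean and the constant 10.94.
theorem prod_eq_sum_esymm_mul_pow {A : Type*} [CommRing A] {n : ℕ} (F : Fin n → A) (G : A) :
    ∏ j, F j = ∑ k ∈ Finset.range (n + 1),
      (∑ J ∈ (Finset.univ : Finset (Fin n)).powersetCard k, ∏ j ∈ J, (F j - G)) * G ^ (n - k) := by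
  have h : ∏ j, F j = ∏ j, ((F j - G) + G) := by simp
  rw [h, Finset.prod_add, Finset.sum_powerset, Finset.card_univ, Fintype.card_fin]
  refine Finset.sum_congr rfl fun k _ => ?_
  rw [Finset.sum_mul]
  refine Finset.sum_congr rfl fun J hJ => ?_
  rw [Finset.prod_const, Finset.card_sdiff_of_subset (Finset.subset_univ J), Finset.card_univ,
    Fintype.card_fin, (Finset.mem_powersetCard.1 hJ).2]

/-- Each of the k factors receives ⌊(n-k)/k⌋ copies of G; the (n-k) mod k remaining copies stay
outside. -/
theorem esymm_mul_pow_eq {A : Type*} [CommRing A] {n : ℕ} (F : Fin n → A) (G : A) (k : ℕ) :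
    (∑ J ∈ (Finset.univ : Finset (Fin n)).powersetCard k, ∏ j ∈ J, (F j - G)) * G ^ (n - k) =
      (∑ J ∈ (Finset.univ : Finset (Fin n)).powersetCard k,
        ∏ j ∈ J, ((F j - G) * G ^ ((n - k) / k))) * G ^ ((n - k) % k) := by
  have h : G ^ (n - k) = (G ^ ((n - k) / k)) ^ k * G ^ ((n - k) % k) := by
    rw [← pow_mul, ← pow_add, mul_comm, Nat.div_add_mod]
  rw [h, ← mul_assoc, Finset.sum_mul]
  congr 1
  refine Finset.sum_congr rfl fun J hJ => ?_
  rw [Finset.prod_mul_distrib, Finset.prod_const, (Finset.mem_powersetCard.1 hJ).2]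

/-- A bound of the norm of the `k`-th term of the expansion of `∏ j, F j` around its mean. -/
noncomputable def termBound : ℕ → ℝ
  | 2 => 1
  | 3 => 741 / 1000
  | 4 => 1 / 2 * (856 / 1000) ^ 2
  | 5 => 5 / 6 * (957 / 1000) ^ 3
  | 6 => 11 / 24 * (1048 / 1000) ^ 4
  | 7 => 7 / 24 * (1132 / 1000) ^ 5
  | 8 => 35 / 144 * (1210 / 1000) ^ 6
  | 9 => 17 / 144 * (1283 / 1000) ^ 7
  | 10 => 83 / 1152 * (1353 / 1000) ^ 8
  | k => 38056 / 10000 * (8342 / 10000) ^ (k - 2)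

theorem termBound_of_le {k : ℕ} (hk : 11 ≤ k) :
    termBound k = 38056 / 10000 * (8342 / 10000) ^ (k - 2) := by
  match k, hk with
  | k + 11, _ => rfl

theorem sum_termBound_le (n : ℕ) : ∑ k ∈ Finset.Ico 2 (n + 1), termBound k ≤ 10.94 := by
  have hnn (k : ℕ) (hk : 2 ≤ k) : 0 ≤ termBound k := by
    rcases le_or_gt 11 k with h | h
    · rw [termBound_of_le h]; positivity
    · interval_cases k <;> norm_num [termBound]
  -- Enlarging the range makes all terms below 11 present for every n; the others form a geometric
  -- tail.
  have h1 : ∑ k ∈ Finset.Ico 2 (n + 1), termBound k ≤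
      ∑ k ∈ Finset.Ico 2 (n + 11), termBound k :=
    Finset.sum_le_sum_of_subset_of_nonneg (Finset.Ico_subset_Ico_right (by omega))
      fun k hk _ => hnn k (Finset.mem_Ico.1 hk).1
  rw [← Finset.sum_Ico_consecutive _ (show 2 ≤ 11 by norm_num) (show 11 ≤ n + 11 by omega)] at h1
  have h2 : ∑ k ∈ Finset.Ico 11 (n + 11), termBound k ≤
      38056 / 10000 * ((8342 / 10000) ^ 9 / (1 - 8342 / 10000)) := by
    have h3 : ∑ k ∈ Finset.Ico 11 (n + 11), termBound k =
        38056 / 10000 * ∑ k ∈ Finset.Ico 9 (n + 9), (8342 / 10000 : ℝ) ^ k := by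
      rw [Finset.mul_sum, show n + 11 = n + 9 + 2 by ring, show 11 = 9 + 2 by norm_num,
        ← Finset.sum_Ico_add']
      refine Finset.sum_congr rfl fun k hk => ?_
      rw [termBound_of_le (by have := (Finset.mem_Ico.1 hk).1; omega), Nat.add_sub_cancel]
    rw [h3]
    gcongr
    exact geom_sum_Ico_le_of_lt_one (by norm_num) (by norm_num)
  refine h1.trans ((add_le_add_right h2 _).trans ?_)
  norm_num [Finset.sum_Ico_succ_top, termBound]

/-- Two of the k + 2 factors √((k+2)h) supply the factor h; the others are bounded by a rational r ≥
√((k+2)·100/547). -/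
theorem expCoeff_mul_le {h r : ℝ} (hh : 0 ≤ h) (h1 : h ≤ 100 / 547) {k : ℕ} (hr : 0 ≤ r)
    (hkr : ((k + 2 : ℕ) : ℝ) * (100 / 547) ≤ r ^ 2) :
    expCoeff 1 1 (k + 2) * √((k + 2 : ℕ) * h) ^ (k + 2) ≤
      expCoeff 1 1 (k + 2) * (k + 2) * r ^ k * h := by
  have h2 : √((k + 2 : ℕ) * h) ≤ r := by
    rw [Real.sqrt_le_left hr]
    exact (mul_le_mul_of_nonneg_left h1 (Nat.cast_nonneg _)).trans hkr
  have h3 := (expCoeff_mono zero_le_one zero_le_one le_rfl le_rfl (k + 2)).1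
  rw [pow_add, Real.sq_sqrt (by positivity)]
  calc _ ≤ expCoeff 1 1 (k + 2) * (r ^ k * ((k + 2 : ℕ) * h)) := by gcongr
    _ = _ := by push_cast; ring

theorem expCoeff_mul_le_termBound {h : ℝ} (hh : 0 ≤ h) (h1 : h ≤ 100 / 547) {k : ℕ} (hk : 2 ≤ k)
    (hk' : k < 11) : expCoeff 1 1 k * √(k * h) ^ k ≤ termBound k * h := by
  interval_cases k
  · refine (expCoeff_mul_le hh h1 (k := 0) (r := 1) ?_ ?_).trans_eq ?_ <;>
      norm_num [expCoeff, termBound]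
  · refine (expCoeff_mul_le hh h1 (k := 1) (r := 741 / 1000) ?_ ?_).trans_eq ?_ <;>
      norm_num [expCoeff, termBound]
  · refine (expCoeff_mul_le hh h1 (k := 2) (r := 856 / 1000) ?_ ?_).trans_eq ?_ <;>
      norm_num [expCoeff, termBound]
  · refine (expCoeff_mul_le hh h1 (k := 3) (r := 957 / 1000) ?_ ?_).trans_eq ?_ <;>
      norm_num [expCoeff, termBound]
  · refine (expCoeff_mul_le hh h1 (k := 4) (r := 1048 / 1000) ?_ ?_).trans_eq ?_ <;>
      norm_num [expCoeff, termBound]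
  · refine (expCoeff_mul_le hh h1 (k := 5) (r := 1132 / 1000) ?_ ?_).trans_eq ?_ <;>
      norm_num [expCoeff, termBound]
  · refine (expCoeff_mul_le hh h1 (k := 6) (r := 1210 / 1000) ?_ ?_).trans_eq ?_ <;>
      norm_num [expCoeff, termBound]
  · refine (expCoeff_mul_le hh h1 (k := 7) (r := 1283 / 1000) ?_ ?_).trans_eq ?_ <;>
      norm_num [expCoeff, termBound]
  · refine (expCoeff_mul_le hh h1 (k := 8) (r := 1353 / 1000) ?_ ?_).trans_eq ?_ <;>
      norm_num [expCoeff, termBound]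

namespace IsAlgebraSeminorm

variable {A : Type*} [CommRing A] [Algebra ℝ A] {N : A → ℝ} (hN : IsAlgebraSeminorm N)
include hN

/-- Below 11 the sharper coefficients of exp(z²/2 + z³/3) are used. From 11 on, Cauchy's estimate
gives a summable geometric bound, which used for all k would sum to more than 10.94. -/
theorem esymm_le_termBound {n : ℕ} {M : Fin n → A} (hM : ∑ j, M j = 0) {h : ℝ} (hh : 0 < h)
    (h1 : h ≤ 100 / 547) {k : ℕ} (hk : 2 ≤ k) (hMk : ∑ j, N (M j) ^ 2 ≤ k * h) :
    N (∑ J ∈ (Finset.univ : Finset (Fin n)).powersetCard k, ∏ j ∈ J, M j) ≤ termBound k * h := by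
  rcases lt_or_ge k 11 with hk' | hk'
  · exact (hN.esymm_le_expCoeff hM (Real.sqrt_nonneg (k * h))
      (by rwa [Real.sq_sqrt (by positivity)]) k).trans (expCoeff_mul_le_termBound hh.le h1 hk hk')
  · have hu : 0 < √(7 / 5 * h) := Real.sqrt_pos.2 (by positivity)
    have h2 := hN.esymm_mul_pow_le_exp hM (inv_nonneg.2 hu.le) k
    have h3 : 7 / 10 * ((√(7 / 5 * h))⁻¹ ^ 2 * ∑ j, N (M j) ^ 2) ≤ k * (1 / 2) := by
      rw [inv_pow, Real.sq_sqrt (by positivity)]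
      calc _ ≤ 7 / 10 * ((7 / 5 * h)⁻¹ * (k * h)) := by gcongr
        _ = k * (1 / 2) := by field_simp; norm_num
    have h4 := h2.trans (Real.exp_le_exp.2 h3)
    rw [inv_pow, ← div_eq_mul_inv, div_le_iff₀ (by positivity), Real.exp_nat_mul, ← mul_pow] at h4
    have h5 : (Real.exp (1 / 2) * √(7 / 5 * h)) ^ 2 = Real.exp 1 * (7 / 5 * h) := by
      rw [mul_pow, Real.sq_sqrt (by positivity), ← Real.exp_nat_mul]
      norm_num
    -- The constants of `termBound`: 3.8056 rounds up 7e/5, and 0.8342 rounds up √(7e/5 · 100/547).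
    have h6 := Real.exp_one_lt_d9
    have h7 : Real.exp 1 * (7 / 5 * h) ≤ 38056 / 10000 * h := by nlinarith
    have h8 : Real.exp (1 / 2) * √(7 / 5 * h) ≤ 8342 / 10000 := by
      refine le_of_sq_le_sq ?_ (by norm_num)
      rw [h5]
      nlinarith
    rw [termBound_of_le hk']
    refine h4.trans ?_
    obtain ⟨m, rfl⟩ := Nat.exists_eq_add_of_le' hk
    rw [pow_add, h5, Nat.add_sub_cancel, mul_right_comm, mul_comm]
    gcongr

theorem prod_sub_pow_le {n : ℕ} (hn : 1 ≤ n) {F : Fin n → A} {G : A} (hF : ∀ j, N (F j) ≤ 1)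
    (hG : N G ≤ 1) (hFG : ∑ j, (F j - G) = 0) {h : ℝ} (hh : 0 < h)
    (hk : ∀ k, 2 ≤ k → k ≤ n → ∑ j, N ((F j - G) * G ^ ((n - k) / k)) ^ 2 ≤ k * h) :
    N (∏ j, F j - G ^ n) ≤ 10.94 * h := by
  -- 100/547 = 2/10.94: beyond it the trivial bound 2 is at most 10.94 h.
  rcases le_or_gt h (100 / 547) with h1 | h1
  · have e : ∏ j, F j - G ^ n = ∑ k ∈ Finset.Ico 2 (n + 1),
        (∑ J ∈ (Finset.univ : Finset (Fin n)).powersetCard k, ∏ j ∈ J, (F j - G)) *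
          G ^ (n - k) := by
      rw [prod_eq_sum_esymm_mul_pow F G, Finset.range_eq_Ico,
        Finset.sum_eq_sum_Ico_succ_bot (by omega), Finset.sum_eq_sum_Ico_succ_bot (by omega)]
      simp [Finset.powersetCard_one, hFG]
    rw [e]
    refine (hN.sum_le _ _).trans ?_
    refine le_trans ?_ (mul_le_mul_of_nonneg_right (sum_termBound_le n) hh.le)
    rw [Finset.sum_mul]
    refine Finset.sum_le_sum fun k hkn => ?_
    obtain ⟨hk2, hkn⟩ := Finset.mem_Ico.1 hkn
    rw [esymm_mul_pow_eq]
    refine (hN.mul_le_left (hN.pow_le_one hG _)).trans ?_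
    exact hN.esymm_le_termBound (by rw [← Finset.sum_mul, hFG, zero_mul]) hh h1 hk2
      (hk k hk2 (by omega))
  · have h2 := hN.add_le (∏ j, F j) (-G ^ n)
    rw [hN.neg, ← sub_eq_add_neg] at h2
    have h3 := hN.prod_le_one Finset.univ F fun j _ => hF j
    have h4 := hN.pow_le_one hG n
    norm_num
    linarith

end IsAlgebraSeminorm
-- The quantities η_ℓ and ũ_1 for signed measures.
section Group

variable {X : Type u} [AddCommGroup X] [MeasurableSpace X] [MeasurableSub₂ X]

theorem isAlgebraSeminorm_tvNorm : IsAlgebraSeminorm (tvNorm : SignedMeasure X → ℝ) where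
  add_le := tvNorm_add_le
  smul := tvNorm_smul
  mul_le := tvNorm_conv_le
  one_le := tvNorm_unit.le

theorem sum_sub_average {n : ℕ} (hn : 1 ≤ n) (F : Fin n → SignedMeasure X) :
    ∑ j, (F j - average F) = 0 := by
  have hn' : (n : ℝ) ≠ 0 := by positivity
  rw [Finset.sum_sub_distrib, Finset.sum_const, Finset.card_univ, Fintype.card_fin, average,
    ← Nat.cast_smul_eq_nsmul ℝ, smul_smul, mul_inv_cancel₀ hn', one_smul, sub_self]

theorem M_eq {n : ℕ} (F : Fin n → SignedMeasure X) (G : SignedMeasure X) (j : Fin n) (k : ℕ) :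
    M F G j k = (F j - G) * G ^ ((n - k) / k) := by
  rw [M, convPow_eq_pow, conv_eq_mul]

/-- This removes c₁ from η_ℓ altogether. -/
theorem nuTilde_average {n : ℕ} (hn : 1 ≤ n) (F : Fin n → SignedMeasure X) (k : ℕ) :
    nuTilde F (average F) k = 0 := by
  simp_rw [nuTilde, M_eq]
  rw [← Finset.sum_mul, sum_sub_average hn, zero_mul, tvNorm_zero]

theorem W_one_average {n : ℕ} (hn : 1 ≤ n) (F : Fin n → SignedMeasure X) :
    W F (average F) 1 = average F ^ n := by
  simp only [W, V, Finset.sum_range_succ, Finset.sum_range_zero, convProd_eq_prod, conv_eq_mul,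
    convPow_eq_pow]
  simp [Finset.powersetCard_one, sum_sub_average hn]

theorem eta_average {n : ℕ} (hn : 1 ≤ n) (F : Fin n → SignedMeasure X) (l : ℕ) :
    eta F (average F) l =
      sSup ((fun k : ℕ => 1 / (k : ℝ) * nu F (average F) k 2) '' Set.Ioc l n) := by
  simp [eta, etaAlpha, nuTilde_average hn]

omit [MeasurableSub₂ X] in
theorem nu_nonneg {n : ℕ} (F : Fin n → SignedMeasure X) (G : SignedMeasure X) (k m : ℕ) :
    0 ≤ nu F G k m := Finset.sum_nonneg fun _ _ => pow_nonneg (tvNorm_nonneg _) _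

theorem eta_average_nonneg {n : ℕ} (hn : 1 ≤ n) (F : Fin n → SignedMeasure X) (l : ℕ) :
    0 ≤ eta F (average F) l := by
  rw [eta_average hn]
  refine Real.sSup_nonneg ?_
  rintro _ ⟨k, -, rfl⟩
  exact mul_nonneg (by positivity) (nu_nonneg _ _ _ _)

theorem eta_average_le {n : ℕ} (hn : 1 ≤ n) (F : Fin n → SignedMeasure X) {l : ℕ} {B : ℝ}
    (hB : 0 ≤ B) (h : ∀ k, l < k → k ≤ n → 1 / (k : ℝ) * nu F (average F) k 2 ≤ B) :
    eta F (average F) l ≤ B := by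
  rw [eta_average hn]
  refine Real.sSup_le ?_ hB
  rintro _ ⟨k, hk, rfl⟩
  exact h k hk.1 hk.2

theorem nu_le_mul_eta_average {n : ℕ} (hn : 1 ≤ n) (F : Fin n → SignedMeasure X) {l k : ℕ}
    (hk : l < k) (hkn : k ≤ n) : nu F (average F) k 2 ≤ k * eta F (average F) l := by
  have hk0 : (0 : ℝ) < k := by exact_mod_cast (Nat.zero_le l).trans_lt hk
  have h : 1 / (k : ℝ) * nu F (average F) k 2 ≤ eta F (average F) l := by
    rw [eta_average hn]
    exact le_csSup ((Set.finite_Ioc l n).image _).bddAbove ⟨k, ⟨hk, hkn⟩, rfl⟩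
  rwa [one_div, inv_mul_le_iff₀ hk0] at h

theorem tvNorm_average_ofProb_le {n : ℕ} (hn : 1 ≤ n) (P : Fin n → ProbabilityMeasure X) :
    tvNorm (average fun j => ofProb (P j)) ≤ 1 := by
  have hn' : (n : ℝ) ≠ 0 := by positivity
  rw [average, Finset.smul_sum]
  exact isAlgebraSeminorm_tvNorm.sum_smul_le_one (fun _ => by positivity)
    (by simp [hn']) fun j => (tvNorm_ofProb (P j)).le

theorem tvNorm_convProd_sub_W_le {n : ℕ} (hn : 1 ≤ n) (P : Fin n → ProbabilityMeasure X) :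
    tvNorm (convProd (fun j => ofProb (P j)) Finset.univ -
      W (fun j => ofProb (P j)) (average fun j => ofProb (P j)) 1) ≤
        10.94 * eta (fun j => ofProb (P j)) (average fun j => ofProb (P j)) 1 := by
  rw [W_one_average hn, convProd_eq_prod]
  set F := fun j => ofProb (P j)
  have h0 := eta_average_nonneg hn F 1
  -- η_1 may be 0 while `prod_sub_pow_le` needs h > 0, hence the passage to the limit h ↓ η_1.
  have key (h : ℝ) (hh : eta F (average F) 1 < h) :
      tvNorm (∏ j, F j - average F ^ n) ≤ 10.94 * h := by
    refine isAlgebraSeminorm_tvNorm.prod_sub_pow_le hn (fun j => (tvNorm_ofProb (P j)).le)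
      (tvNorm_average_ofProb_le hn P) (sum_sub_average hn F) (h0.trans_lt hh) fun k hk hkn => ?_
    have h1 := nu_le_mul_eta_average hn F hk hkn
    simp_rw [nu, M_eq] at h1
    exact h1.trans (mul_le_mul_of_nonneg_left hh.le (Nat.cast_nonneg k))
  have h1 : tvNorm (∏ j, F j - average F ^ n) / 10.94 ≤ eta F (average F) 1 :=
    le_of_forall_gt_imp_ge_of_dense fun h hh =>
      (div_le_iff₀' (by norm_num)).2 (key h hh)
  exact (div_le_iff₀' (by norm_num)).1 h1

theorem uTilde_one_le : uTilde.{u} 1 ≤ 10.94 := by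
  refine csInf_le ⟨0, fun c hc => hc.1.le⟩ ⟨by norm_num, ?_⟩
  intro Y _ _ _ n P hn _
  have h := tvNorm_convProd_sub_W_le hn P
  norm_num at h ⊢
  exact h

theorem uTilde_one_nonneg : 0 ≤ uTilde.{u} 1 := Real.sInf_nonneg fun _ hc => hc.1.le

/-- The infimum ũ_1 is itself admissible: for η_1 > 0 divide by η_1 and take the infimum over c; for
η_1 = 0 the bound with 10.94 already gives norm 0. -/
theorem tvNorm_convProd_sub_convPow_le {n : ℕ} (hn : 1 ≤ n) (P : Fin n → ProbabilityMeasure X) :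
    tvNorm (convProd (fun j => ofProb (P j)) Finset.univ -
      convPow (average fun j => ofProb (P j)) n) ≤
        uTilde.{u} 1 * eta (fun j => ofProb (P j)) (average fun j => ofProb (P j)) 1 := by
  have h10 := tvNorm_convProd_sub_W_le hn P
  rw [W_one_average hn] at h10
  rw [convPow_eq_pow]
  rcases (eta_average_nonneg hn (fun j => ofProb (P j)) 1).eq_or_lt with h0 | h0
  · rw [← h0, mul_zero] at h10 ⊢
    exact h10
  · rw [← div_le_iff₀ h0, uTilde]
    refine le_csInf ⟨10.94, by norm_num, fun Y _ _ _ n P hn _ => ?_⟩ ?_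
    · have h := tvNorm_convProd_sub_W_le hn P
      norm_num at h ⊢
      exact h
    · rintro c ⟨-, hc⟩
      have h := hc X n P hn hn
      rw [W_one_average hn] at h
      rw [div_le_iff₀ h0]
      norm_num at h
      exact h

end Group

/-! ### Mixtures of fixed distributions. -/

theorem ofProb_apply {X : Type*} [MeasurableSpace X] (P : ProbabilityMeasure X) {s : Set X}
    (hs : MeasurableSet s) : ofProb P s = (P : Measure X).real s :=
  Measure.toSignedMeasure_apply_measurable hs

theorem exists_ofProb_eq_sum {X : Type*} [MeasurableSpace X] {ι : Type*} [Fintype ι]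
    (H : ι → ProbabilityMeasure X) {q : ι → ℝ} (hq : ∀ r, 0 ≤ q r) (hq1 : ∑ r, q r = 1) :
    ∃ P : ProbabilityMeasure X, ofProb P = ∑ r, q r • ofProb (H r) := by
  have hP : IsProbabilityMeasure (∑ r, ENNReal.ofReal (q r) • (H r : Measure X)) :=
    ⟨by simp [← ENNReal.ofReal_sum_of_nonneg fun r _ => hq r, hq1]⟩
  obtain ⟨P, hPq⟩ : ∃ P : ProbabilityMeasure X,
      (P : Measure X) = ∑ r, ENNReal.ofReal (q r) • (H r : Measure X) := ⟨⟨_, hP⟩, rfl⟩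
  refine ⟨P, ?_⟩
  ext s hs
  rw [ofProb_apply _ hs, hPq]
  simp only [measureReal_def, Measure.coe_finsetSum,
    Finset.sum_apply, Measure.smul_apply, smul_eq_mul]
  rw [ENNReal.toReal_sum (by finiteness)]
  have (V : ι → SignedMeasure X) (t : Finset ι) : (∑ r ∈ t, V r) s = ∑ r ∈ t, V r s := by
    classical
    induction t using Finset.induction_on with
    | empty => simp
    | insert i t hi ih => simp [Finset.sum_insert hi, ih]
  rw [this]
  refine Finset.sum_congr rfl fun r _ => ?_
  rw [ENNReal.toReal_mul, ENNReal.toReal_ofReal (hq r), _root_.smul_apply, ofProb_apply _ hs,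
    measureReal_def, smul_eq_mul]

/-- Let S = ∑_{r ≥ 1} δ_r²/q_r. As δ_0 = -∑_{r ≥ 1} δ_r, Cauchy–Schwarz gives δ_0² ≤ (1 - q_0) S, so
the full sum is at most S + (1 - q_0) S/q_0 = S/q_0. -/
theorem sum_sq_div_le {d : ℕ} {q δ : Fin (d + 1) → ℝ} (hq : ∀ r, 0 < q r) (hq1 : ∑ r, q r = 1)
    (hδ : ∑ r, δ r = 0) :
    ∑ r, δ r ^ 2 / q r ≤ ∑ r : Fin d, δ r.succ ^ 2 / (q r.succ * q 0) := by
  rw [Fin.sum_univ_succ] at hq1 hδ ⊢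
  have h0 := hq 0
  have h1 : (∑ r : Fin d, δ r.succ) ^ 2 ≤
      (∑ r : Fin d, q r.succ) * ∑ r : Fin d, δ r.succ ^ 2 / q r.succ :=
    Finset.sum_sq_le_sum_mul_sum_of_sq_le_mul _ (fun r _ => (hq _).le)
      (fun r _ => div_nonneg (sq_nonneg _) (hq _).le)
      fun r _ => by rw [mul_div_cancel₀ _ (hq _).ne']
  have h2 : ∑ r : Fin d, δ r.succ ^ 2 / (q r.succ * q 0) =
      (∑ r : Fin d, δ r.succ ^ 2 / q r.succ) / q 0 := by
    rw [Finset.sum_div]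
    exact Finset.sum_congr rfl fun r _ => (div_div _ _ _).symm
  rw [h2, show δ 0 = -∑ r : Fin d, δ r.succ by linarith, neg_sq, le_div_iff₀ h0, add_mul,
    div_mul_cancel₀ _ h0.ne']
  rw [show ∑ r : Fin d, q r.succ = 1 - q 0 by linarith] at h1
  linarith

end SignedConv

theorem mainTheorem8 {X : Type u} [AddCommGroup X] [MeasurableSpace X] [MeasurableSub₂ X]
    (n d : ℕ) (hn : 1 ≤ n) (hd : 1 ≤ d)
    (H : Fin (d + 1) → ProbabilityMeasure X)
    (p : Fin n → Fin (d + 1) → ℝ)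
    (hp : ∀ j r, p j r ∈ Set.Icc (0 : ℝ) 1)
    (hp_sum : ∀ j, ∑ r, p j r = 1)
    (pbar : Fin (d + 1) → ℝ)
    (hpbar : ∀ r, pbar r = 1 / (n : ℝ) * ∑ j, p j r)
    (hpbar_pos : ∀ r, 0 < pbar r)
    (F : Fin n → SignedMeasure X)
    (hF : ∀ j, F j = ∑ r, p j r • SignedConv.ofProb (H r)) :
    (∀ l : ℕ, 1 ≤ l → l ≤ n →
      SignedConv.eta F (SignedConv.average F) l ≤
        ∑ j, min (2 * ∑ r, (pbar r - p j r) ^ 2 / ((n : ℝ) * pbar r))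
          (1 / ((l : ℝ) + 1) * (∑ r, |pbar r - p j r|) ^ 2)) ∧
    SignedConv.tvNorm
        (SignedConv.convProd F Finset.univ - SignedConv.convPow (SignedConv.average F) n) ≤
      2 * SignedConv.uTilde.{u} 1 *
        ∑ r : Fin d, ∑ j, (pbar r.succ - p j r.succ) ^ 2 / ((n : ℝ) * pbar r.succ * pbar 0) ∧
    2 * SignedConv.uTilde.{u} 1 ≤ 21.88 ∧
    SignedConv.tvNorm
        (SignedConv.convProd F Finset.univ - SignedConv.convPow (SignedConv.average F) n) ≤
      21.88 *
        ∑ r : Fin d, ∑ j, (pbar r.succ - p j r.succ) ^ 2 / ((n : ℝ) * pbar r.succ * pbar 0) := by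
  classical
  have hn0 : (0 : ℝ) < n := by exact_mod_cast hn
  have hpbar_sum : ∑ r, pbar r = 1 := by
    simp_rw [hpbar]
    rw [← Finset.mul_sum, Finset.sum_comm]
    simp [hp_sum, hn0.ne']
  have hδ (j : Fin n) : ∑ r, (p j r - pbar r) = 0 := by
    rw [Finset.sum_sub_distrib, hp_sum, hpbar_sum, sub_self]
  have hG : SignedConv.average F = ∑ r, pbar r • SignedConv.ofProb (H r) := by
    simp_rw [SignedConv.average, hF, hpbar]
    rw [Finset.sum_comm, Finset.smul_sum]
    refine Finset.sum_congr rfl fun r _ => ?_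
    rw [← Finset.sum_smul, smul_smul, one_div]
  have hFG (j : Fin n) : F j - SignedConv.average F =
      ∑ r, (p j r - pbar r) • SignedConv.ofProb (H r) := by
    simp_rw [hG, hF, sub_smul, Finset.sum_sub_distrib]
  have hH (r : Fin (d + 1)) : SignedConv.tvNorm (SignedConv.ofProb (H r)) ≤ 1 :=
    (SignedConv.tvNorm_ofProb (H r)).le
  have hN : SignedConv.IsAlgebraSeminorm (SignedConv.tvNorm : SignedMeasure X → ℝ) :=
    SignedConv.isAlgebraSeminorm_tvNorm
  have heta (l : ℕ) (hl : 1 ≤ l) : SignedConv.eta F (SignedConv.average F) l ≤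
      ∑ j, min (2 * ∑ r, (pbar r - p j r) ^ 2 / ((n : ℝ) * pbar r))
        (1 / ((l : ℝ) + 1) * (∑ r, |pbar r - p j r|) ^ 2) := by
    refine SignedConv.eta_average_le hn F (Finset.sum_nonneg fun j _ => le_min ?_ ?_)
      fun k hk hkn => ?_
    · exact mul_nonneg zero_le_two (Finset.sum_nonneg fun r _ =>
        div_nonneg (sq_nonneg _) (mul_pos hn0 (hpbar_pos r)).le)
    · positivity
    have hk0 : (0 : ℝ) < k := by exact_mod_cast (Nat.zero_le l).trans_lt hk
    rw [SignedConv.nu, Finset.mul_sum]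
    refine Finset.sum_le_sum fun j _ => le_min ?_ ?_
    · rw [SignedConv.M_eq, hFG, hG]
      have h1 := hN.sq_sum_smul_mul_pow_le hpbar_pos hpbar_sum (hδ j) hH ((n - k) / k)
      -- The origin of the factor 2: with m = ⌊(n-k)/k⌋, k(m + 1) exceeds n - k and is at least k.
      have h2 : (n : ℝ) ≤ 2 * (k * (((n - k) / k : ℕ) + 1)) := by
        have h3 : n - k < k * ((n - k) / k) + k := by
          have := Nat.lt_mul_div_succ (n - k) (show 0 < k by omega)
          rwa [mul_add, mul_one] at this
        have h4 : n ≤ 2 * (k * ((n - k) / k + 1)) := by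
          rw [mul_add, mul_one]
          generalize k * ((n - k) / k) = a at *
          omega
        exact_mod_cast h4
      have h5 : ∑ r, (pbar r - p j r) ^ 2 / ((n : ℝ) * pbar r) =
          (∑ r, (p j r - pbar r) ^ 2 / pbar r) / n := by
        rw [Finset.sum_div]
        refine Finset.sum_congr rfl fun r _ => ?_
        rw [div_div, mul_comm (n : ℝ), ← neg_sq (pbar r - p j r), neg_sub]
      have h6 : 0 ≤ ∑ r, (p j r - pbar r) ^ 2 / pbar r :=
        Finset.sum_nonneg fun r _ => div_nonneg (sq_nonneg _) (hpbar_pos r).le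
      rw [h5]
      refine (mul_le_mul_of_nonneg_left h1 (by positivity)).trans ?_
      rw [div_mul_div_comm, one_mul, ← mul_div_assoc, div_le_div_iff₀ (by positivity) hn0]
      nlinarith
    · have h1 : SignedConv.tvNorm (SignedConv.M F (SignedConv.average F) j k) ≤
          ∑ r, |pbar r - p j r| := by
        rw [SignedConv.M_eq, hG]
        refine (hN.mul_le_left (hN.pow_le_one (hN.sum_smul_le_one (fun r => (hpbar_pos r).le)
          hpbar_sum hH) _)).trans ?_
        rw [← hG, hFG]
        refine (hN.sum_le _ _).trans (Finset.sum_le_sum fun r _ => ?_)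
        rw [hN.smul, abs_sub_comm]
        exact mul_le_of_le_one_right (abs_nonneg _) (hH r)
      have h2 : (l : ℝ) + 1 ≤ k := by exact_mod_cast hk
      have h3 := SignedConv.tvNorm_nonneg (SignedConv.M F (SignedConv.average F) j k)
      gcongr
  -- The F_j are themselves probability distributions, so ũ_1 applies to them.
  choose P hP using fun j => SignedConv.exists_ofProb_eq_sum H (fun r => (hp j r).1) (hp_sum j)
  have hFP : F = fun j => SignedConv.ofProb (P j) := by
    funext j
    rw [hP, hF]
  have hnn : 0 ≤ ∑ r : Fin d, ∑ j,
      (pbar r.succ - p j r.succ) ^ 2 / ((n : ℝ) * pbar r.succ * pbar 0) :=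
    Finset.sum_nonneg fun r _ => Finset.sum_nonneg fun j _ => div_nonneg (sq_nonneg _)
      (mul_pos (mul_pos hn0 (hpbar_pos _)) (hpbar_pos _)).le
  have heta1 : SignedConv.eta F (SignedConv.average F) 1 ≤ 2 * ∑ r : Fin d, ∑ j,
      (pbar r.succ - p j r.succ) ^ 2 / ((n : ℝ) * pbar r.succ * pbar 0) := by
    refine (heta 1 le_rfl).trans ?_
    rw [Finset.sum_comm, Finset.mul_sum]
    refine Finset.sum_le_sum fun j _ => (min_le_left _ _).trans ?_
    have h1 := SignedConv.sum_sq_div_le hpbar_pos hpbar_sum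
      (δ := fun r => pbar r - p j r) (by rw [Finset.sum_sub_distrib, hp_sum, hpbar_sum, sub_self])
    have h2 := div_le_div_of_nonneg_right h1 hn0.le
    rw [Finset.sum_div, Finset.sum_div] at h2
    simp only [div_div] at h2
    refine mul_le_mul_of_nonneg_left ?_ zero_le_two
    convert h2 using 3 <;> ring
  have hmain : SignedConv.tvNorm
      (SignedConv.convProd F Finset.univ - SignedConv.convPow (SignedConv.average F) n) ≤
      2 * SignedConv.uTilde.{u} 1 *
        ∑ r : Fin d, ∑ j, (pbar r.succ - p j r.succ) ^ 2 / ((n : ℝ) * pbar r.succ * pbar 0) := by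
    have h1 := SignedConv.tvNorm_convProd_sub_convPow_le hn P
    rw [← hFP] at h1
    refine h1.trans ((mul_le_mul_of_nonneg_left heta1 SignedConv.uTilde_one_nonneg).trans_eq ?_)
    ring
  have hu : 2 * SignedConv.uTilde.{u} 1 ≤ 21.88 := by
    have := SignedConv.uTilde_one_le.{u}
    norm_num at this ⊢
    linarith
  exact ⟨fun l hl _ => heta l hl, hmain, hu,
    hmain.trans (mul_le_mul_of_nonneg_right hu hnn)⟩
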